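/- Let $N\ge 2$, let $Q,B$ be real $N\times N$ matrices with $Q=Q^*\ge 0$, and put, for $t>0$, $$K(t)=\frac1t\int_0^t e^{\sigma B}Qe^{\sigma B^*}\,d\sigma,\qquad C(t)=\int_0^t e^{-\sigma B}Qe^{-\sigma B^*}\,d\sigma .$$ Assume that $K(t)>0$ (positive definite) for every $t>0$. Let $$p(X,Y,t)=\frac{c_N}{V(t)}\exp\Big(-\frac{m_t(X,Y)^2}{4t}\Big),\qquad m_t(X,Y)=\big\langle K(t)^{-1}(Y-e^{tB}X),\,Y-e^{tB}X\big\rangle^{1/2},$$ where $V(t)=\omega_N\det(tK(t))^{1/2}$, $\omega_N$ is the volume of the unit ball of $\mathbb R^N$, and $c_N^{-1}=4^{N/2}\,\Gamma(\tfrac N2+1)$. For $a>-1$ and $z,\zeta,t>0$ let $$p^{(a)}(z,\zeta,t)=(2t)^{-\frac{a+1}2}\Big(\frac{z\zeta}{2t}\Big)^{\frac{1-a}2}I_{\frac{a-1}2}\Big(\frac{z\zeta}{2t}\Big)e^{-\frac{z^2+\zeta^2}{4t}},$$ where $I_\nu$ is the modified Bessel function of the first kind, and let $p^{(a)}(0,\zeta,t)=\lim_{z\to0^+}p^{(a)}(z,\zeta,t)=\frac{1}{2^a\Gamma(\frac{a+1}2)}\,t^{-\frac{a+1}2}e^{-\frac{\zeta^2}{4t}}$.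 For $\varphi\in C_0^\infty(\mathbb R^{N+1}_+)$, where $\mathbb R^{N+1}_+=\mathbb R^N\times(0,\infty)$, define for $X\in\mathbb R^N$, $z\ge0$, $t>0$ $$\mathscr P^{(a)}_t\varphi(X,z)=\int_0^\infty\!\int_{\mathbb R^N}p(X,Y,t)\,p^{(a)}(z,\zeta,t)\,\varphi(Y,\zeta)\,\zeta^a\,dY\,d\zeta .$$ Let $\varphi\in C_0^\infty(\mathbb R^{N+1}_+)$ with $\varphi\ge0$, let $X,Y\in\mathbb R^N$ and $0<s<t<\infty$. Then for every $a\ge0$ and all $z,\zeta>0$, $$\mathscr P^{(a)}_s\varphi(Y,\zeta)\le \mathscr P^{(a)}_t\varphi(X,z)\Big(\frac ts\Big)^{\frac{N+a+1}2}\Big(\frac{\det K(t)}{\det K(s)}\Big)^{\frac12}\exp\Big(\frac{|z-\zeta|^2}{4(t-s)}\Big)\exp\Big(\tfrac14\big\langle C(t-s)^{-1}(X-e^{-(t-s)B}Y),\,X-e^{-(t-s)B}Y\big\rangle\Big).$$ Moreover, for $z=\zeta=0$ the inequality holds for every $a>-1$: $$\mathscr P^{(a)}_s\varphi(Y,0)\le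 \mathscr P^{(a)}_t\varphi(X,0)\Big(\frac ts\Big)^{\frac{N+a+1}2}\Big(\frac{\det K(t)}{\det K(s)}\Big)^{\frac12}\exp\Big(\tfrac14\big\langle C(t-s)^{-1}(X-e^{-(t-s)B}Y),\,X-e^{-(t-s)B}Y\big\rangle\Big).$$ -/

import Mathlib

open MeasureTheory Set Filter Topology
open scoped Matrix ContDiff

noncomputable section

namespace KolmogorovExtension

/-- The points of `ℝ^N`. No norm of this type is used below: all quadratic forms are written with
the Euclidean scalar product `⬝ᵥ`, and `volume` is Lebesgue measure. -/
abbrev Pt (N : ℕ) : Type := Fin N → ℝ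

/-- The matrix `∫_0^t e^{sB} Q e^{sB^*} ds`, integrated entry by entry. -/
def covInt {N : ℕ} (Q B : Matrix (Fin N) (Fin N) ℝ) (t : ℝ) : Matrix (Fin N) (Fin N) ℝ :=
  Matrix.of fun i j =>
    ∫ s in (0 : ℝ)..t, (NormedSpace.exp (s • B) * Q * NormedSpace.exp (s • Bᵀ)) i j

/-- The covariance matrix `K(t) = (1/t) ∫_0^t e^{sB} Q e^{sB^*} ds`. -/
def K {N : ℕ} (Q B : Matrix (Fin N) (Fin N) ℝ) (t : ℝ) : Matrix (Fin N) (Fin N) ℝ :=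
  (1 / t) • covInt Q B t

/-- The matrix `C(t) = ∫_0^t e^{-sB} Q e^{-sB^*} ds`, integrated entry by entry. -/
def C {N : ℕ} (Q B : Matrix (Fin N) (Fin N) ℝ) (t : ℝ) : Matrix (Fin N) (Fin N) ℝ :=
  Matrix.of fun i j =>
    ∫ s in (0 : ℝ)..t, (NormedSpace.exp (-(s • B)) * Q * NormedSpace.exp (-(s • Bᵀ))) i j

/-- The intertwined pseudo-distance
`m_t(X,Y) = ⟨K(t)⁻¹ (Y - e^{tB} X), Y - e^{tB} X⟩^{1/2}`. -/
def pseudoDist {N : ℕ} (Q B : Matrix (Fin N) (Fin N) ℝ) (t : ℝ) (X Y : Pt N) : ℝ :=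
  √(((K Q B t)⁻¹ *ᵥ (Y - NormedSpace.exp (t • B) *ᵥ X)) ⬝ᵥ (Y - NormedSpace.exp (t • B) *ᵥ X))

/-- The volume `ω_N` of the Euclidean unit ball of `ℝ^N`. -/
def unitBallVolume (N : ℕ) : ℝ :=
  (volume (Metric.ball (0 : EuclideanSpace ℝ (Fin N)) 1)).toReal

/-- The volume function `V(t) = ω_N (det (t K(t)))^{1/2}`. -/
def V {N : ℕ} (Q B : Matrix (Fin N) (Fin N) ℝ) (t : ℝ) : ℝ :=
  unitBallVolume N * √((t • K Q B t).det)

/-- The normalizing constant `c_N`, with `c_N⁻¹ = 4^{N/2} Γ(N/2 + 1)`. -/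
def normConst (N : ℕ) : ℝ :=
  ((4 : ℝ) ^ ((N : ℝ) / 2) * Real.Gamma ((N : ℝ) / 2 + 1))⁻¹

/-- The transition kernel `p(X,Y,t) = (c_N / V(t)) exp(-m_t(X,Y)² / (4t))` of
`tr(Q ∇²) + ⟨BX, ∇⟩`. -/
def heatKernel {N : ℕ} (Q B : Matrix (Fin N) (Fin N) ℝ) (X Y : Pt N) (t : ℝ) : ℝ :=
  normConst N / V Q B t * Real.exp (-(pseudoDist Q B t X Y) ^ 2 / (4 * t))

/-- The modified Bessel function of the first kind
`I_ν(y) = ∑_k (y/2)^{2k+ν} / (k! Γ(k+ν+1))`, for `y > 0`. -/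
def besselI (ν y : ℝ) : ℝ :=
  ∑' k : ℕ, (y / 2) ^ (2 * (k : ℝ) + ν) / ((k.factorial : ℝ) * Real.Gamma ((k : ℝ) + ν + 1))

/-- The kernel `p^{(a)}(z,ζ,t)` of the semigroup generated by the Bessel operator
`∂_z² + (a/z) ∂_z` with Neumann condition. For `z > 0` it is
`(2t)^{-(a+1)/2} (zζ/2t)^{(1-a)/2} I_{(a-1)/2}(zζ/2t) e^{-(z²+ζ²)/4t}`; at `z = 0` it is the limit
of this expression as `z → 0⁺` (see `besselKernel_tendsto_zero`). -/
def besselKernel (a z ζ t : ℝ) : ℝ :=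
  if z = 0 then
    1 / ((2 : ℝ) ^ a * Real.Gamma ((a + 1) / 2)) * t ^ (-(a + 1) / 2) * Real.exp (-ζ ^ 2 / (4 * t))
  else
    (2 * t) ^ (-(a + 1) / 2) * (z * ζ / (2 * t)) ^ ((1 - a) / 2) *
      besselI ((a - 1) / 2) (z * ζ / (2 * t)) * Real.exp (-(z ^ 2 + ζ ^ 2) / (4 * t))

/-- The Neumann fundamental solution
`𝒢^{(a)}(X,t,z;Y,τ,ζ) = p(X,Y,t-τ) p^{(a)}(z,ζ,t-τ)` of the extension operator. -/
def neumannKernel {N : ℕ} (Q B : Matrix (Fin N) (Fin N) ℝ) (a : ℝ)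
    (X : Pt N) (t z : ℝ) (Y : Pt N) (τ ζ : ℝ) : ℝ :=
  heatKernel Q B X Y (t - τ) * besselKernel a z ζ (t - τ)

/-- The extension semigroup
`P_t^{(a)} φ (X,z) = ∫_0^∞ ∫_{ℝ^N} 𝒢^{(a)}(X,t,z;Y,0,ζ) φ(Y,ζ) ζ^a dY dζ`. -/
def extSemigroup {N : ℕ} (Q B : Matrix (Fin N) (Fin N) ℝ) (a t : ℝ)
    (φ : Pt N × ℝ → ℝ) (X : Pt N) (z : ℝ) : ℝ :=
  ∫ ζ in Ioi (0 : ℝ), ∫ Y : Pt N, neumannKernel Q B a X t z Y 0 ζ * φ (Y, ζ) * ζ ^ a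

/-- The class `C_0^∞(ℝ^{N+1}_+)` of smooth functions with compact support in the open half-space
`ℝ^N × (0,∞)` (extended by zero to `ℝ^N × ℝ`). -/
def IsTestFunction {N : ℕ} (φ : Pt N × ℝ → ℝ) : Prop :=
  ContDiff ℝ ∞ φ ∧ HasCompactSupport φ ∧ tsupport φ ⊆ {P | 0 < P.2}

/-- The value of the Bessel kernel at `z = 0` is its limit as `z → 0⁺`. -/
theorem besselKernel_tendsto_zero {a ζ t : ℝ} (ha : -1 < a) (hζ : 0 < ζ) (ht : 0 < t) :
    Tendsto (fun z => besselKernel a z ζ t) (𝓝[>] 0) (𝓝 (besselKernel a 0 ζ t)) := by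
  set ν : ℝ := (a - 1) / 2 with hν
  have hν1 : 0 < ν + 1 := by rw [hν]; linarith
  have hG : ∀ k : ℕ, 0 < Real.Gamma ((k : ℝ) + ν + 1) := fun k =>
    Real.Gamma_pos_of_pos (by have : (0 : ℝ) ≤ k := k.cast_nonneg; linarith)
  let c : ℕ → ℝ := fun k => 1 / ((k.factorial : ℝ) * Real.Gamma ((k : ℝ) + ν + 1))
  have hc : ∀ k, 0 < c k := fun k => by
    have := hG k
    have h2 : (0 : ℝ) < k.factorial := by exact_mod_cast k.factorial_pos
    positivity
  have hcs : ∀ k : ℕ, c k = c (k + 1) * (((k : ℝ) + 1) * ((k : ℝ) + ν + 1)) := fun k => by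
    have h1 : Real.Gamma (((k + 1 : ℕ) : ℝ) + ν + 1)
        = ((k : ℝ) + ν + 1) * Real.Gamma ((k : ℝ) + ν + 1) := by
      rw [← Real.Gamma_add_one (by have : (0 : ℝ) ≤ k := k.cast_nonneg; linarith)]
      congr 1; push_cast; ring
    have h2 : (0 : ℝ) < k.factorial := by exact_mod_cast k.factorial_pos
    have h3 : (0 : ℝ) < (k : ℝ) + ν + 1 := by have : (0 : ℝ) ≤ k := k.cast_nonneg; linarith
    have h4 := hG k
    simp only [c]
    rw [h1, Nat.factorial_succ]
    push_cast
    field_simp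
  have hsum : Summable c := by
    refine summable_of_ratio_norm_eventually_le (r := 1 / 2) (by norm_num) ?_
    filter_upwards [eventually_ge_atTop 1] with k hk
    have hk' : (1 : ℝ) ≤ k := by exact_mod_cast hk
    rw [Real.norm_of_nonneg (hc _).le, Real.norm_of_nonneg (hc _).le, hcs k]
    have := hc (k + 1)
    nlinarith [mul_nonneg this.le (by nlinarith : 0 ≤ ((k : ℝ) + 1) * ((k : ℝ) + ν + 1) - 2)]
  let g : ℝ → ℝ := fun y => ∑' k : ℕ, c k * ((y / 2) ^ 2) ^ k
  have hg : ContinuousOn g (Icc 0 1) := by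
    refine continuousOn_tsum (fun k => by fun_prop) hsum fun k y hy => ?_
    rw [Real.norm_of_nonneg (by have := hc k; positivity)]
    refine mul_le_of_le_one_right (hc k).le (pow_le_one₀ (by positivity) ?_)
    nlinarith [hy.1, hy.2]
  have hg0 : g 0 = c 0 := by
    simp only [g]
    rw [tsum_eq_single 0 (fun k hk => by simp [hk])]
    simp
  have hI : ∀ y : ℝ, 0 < y → y ^ ((1 - a) / 2) * besselI ν y = 2 ^ (-ν) * g y := fun y hy => by
    have hy2 : 0 < y / 2 := by positivity
    have h1 : besselI ν y = (y / 2) ^ ν * g y := by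
      simp only [besselI, g]
      rw [← tsum_mul_left]
      refine tsum_congr fun k => ?_
      rw [Real.rpow_add hy2, mul_comm (2 : ℝ), mul_comm (k : ℝ), Real.rpow_mul hy2.le]
      simp only [c, Real.rpow_natCast, Real.rpow_ofNat]
      ring
    rw [h1, show (1 - a) / 2 = -ν by rw [hν]; ring, Real.div_rpow hy.le (by norm_num),
      Real.rpow_neg hy.le, Real.rpow_neg (by norm_num)]
    have := Real.rpow_pos_of_pos hy ν
    field_simp
  have hlim : Tendsto (fun z : ℝ => z * ζ / (2 * t)) (𝓝[>] 0) (𝓝[Icc 0 1] 0) := by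
    refine tendsto_nhdsWithin_iff.2 ⟨?_, ?_⟩
    · have h : Continuous fun z : ℝ => z * ζ / (2 * t) := by fun_prop
      simpa using (h.tendsto 0).mono_left nhdsWithin_le_nhds
    · have h : Ioo (0 : ℝ) (2 * t / ζ) ∈ 𝓝[>] (0 : ℝ) := Ioo_mem_nhdsGT (by positivity)
      filter_upwards [h] with z hz
      have h2 := (lt_div_iff₀ hζ).1 hz.2
      have h3 := hz.1
      exact ⟨by positivity, by rw [div_le_one (by positivity)]; exact h2.le⟩
  have hgl : Tendsto (fun z : ℝ => g (z * ζ / (2 * t))) (𝓝[>] 0) (𝓝 (c 0)) := by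
    rw [← hg0]
    exact (hg 0 (by simp)).tendsto.comp hlim
  have hexp : Tendsto (fun z : ℝ => Real.exp (-(z ^ 2 + ζ ^ 2) / (4 * t))) (𝓝[>] 0)
      (𝓝 (Real.exp (-ζ ^ 2 / (4 * t)))) := by
    have h : Continuous fun z : ℝ => Real.exp (-(z ^ 2 + ζ ^ 2) / (4 * t)) := by fun_prop
    simpa using (h.tendsto 0).mono_left nhdsWithin_le_nhds
  have key := ((hgl.const_mul ((2 : ℝ) ^ (-ν))).const_mul ((2 * t) ^ (-(a + 1) / 2))).mul hexp
  have hval : besselKernel a 0 ζ t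
      = (2 * t) ^ (-(a + 1) / 2) * ((2 : ℝ) ^ (-ν) * c 0) * Real.exp (-ζ ^ 2 / (4 * t)) := by
    have h2 : (2 : ℝ) ^ (-(a + 1) / 2) * (2 : ℝ) ^ (-ν) = ((2 : ℝ) ^ a)⁻¹ := by
      rw [← Real.rpow_add (by norm_num), ← Real.rpow_neg (by norm_num)]
      congr 1; rw [hν]; ring
    simp only [besselKernel, if_true, c]
    rw [Real.mul_rpow (by norm_num) ht.le]
    have h3 : ((0 : ℕ) : ℝ) + ν + 1 = (a + 1) / 2 := by rw [hν]; push_cast; ring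
    rw [h3]
    simp only [Nat.factorial_zero, Nat.cast_one, one_mul, one_div, mul_inv]
    rw [← h2]; ring
  rw [hval]
  refine key.congr' ?_
  filter_upwards [self_mem_nhdsWithin] with z hz
  have hz : 0 < z := hz
  rw [besselKernel, if_neg hz.ne', ← hI _ (by positivity)]
  ring

end KolmogorovExtension

end

open KolmogorovExtension

/-!
The Harnack inequality holds already for the kernels, pointwise in the point of integration
`(W, w)`; integrating against `φ(W, w) w^a` then gives the claim (`extSemigroup_le`). The kernel is
a product, so the Gaussian and the Bessel factor are compared separately.

*Gaussian factor* (`heatKernel_le`). With `P_t = t K(t) = ∫_0^t e^{σB} Q e^{σB^*} dσ` one has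
`P_t = P_s + e^{tB} C(t-s) e^{tB^*}` (`covInt_eq_add`), and
`W - e^{tB} X = (W - e^{sB} Y) - e^{tB} (X - e^{-(t-s)B} Y)`. Since
`⟨A⁻¹ x, x⟩ = max_ξ (2⟨ξ, x⟩ - ⟨A ξ, ξ⟩)`, the form `⟨A⁻¹ x, x⟩` is jointly subadditive in `(A, x)`
(`inv_quadForm_add_le`), which bounds the exponent at time `t` by the one at time `s` plus the form
of `C(t-s)⁻¹`. The ratio of the normalizing constants is the square root of `det P_t / det P_s`.

*Bessel factor* (`besselKernel_le`). Up to constants, `p^{(a)}(z,w,t)` is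
`t^{-(a+1)/2} h(zw/2t) e^{-(z²+w²)/4t}` with `h(y) = y^{-ν} I_ν(y)` and `ν = (a-1)/2`. The function
`h` is increasing because its power series has nonnegative coefficients, and `e^{-y} h(y)` is
decreasing for `ν ≥ -1/2`, that is, for `a ≥ 0`. If `ζw/2s ≤ zw/2t`, the first fact reduces the
comparison to the exponents `-(ζ²+w²)/4s` and `-(z²+w²)/4t`, otherwise the second one reduces it to
`-(ζ-w)²/4s` and `-(z-w)²/4t`; in both cases `(x+y)²/t ≤ x²/s + y²/(t-s)` concludes. At `z = ζ = 0`
the Bessel function is absent, so no restriction beyond `a > -1` is needed.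

That `e^{-y} h(y)` decreases is the inequality `I_{ν+1} ≤ I_ν`. In terms of the series `F_ν` with
`I_ν(y) = (y/2)^ν F_ν(y²/4)`, it follows from `F_ν' = F_{ν+1}` and the contiguity relation
`F_ν = (ν+1) F_{ν+1} + x F_{ν+2}`: together they show that `F_ν² - x F_{ν+1}²` has derivative
`(2ν+1) F_{ν+1}² ≥ 0`, and it is nonnegative at `x = 0`.
-/

namespace KolmogorovExtension

/-! ### Quadratic forms of inverse matrices -/

/-- `⟨A⁻¹ x, x⟩` dominates `2⟨ξ, x⟩ - ⟨A ξ, ξ⟩` for every `ξ`: expand `0 ≤ ⟨A (ξ - y), ξ - y⟩` at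
`y = A⁻¹ x`. -/
theorem two_dotProduct_sub_le {n : Type*} [Fintype n] [DecidableEq n] {A : Matrix n n ℝ}
    (hA : A.PosDef) (ξ x : n → ℝ) :
    2 * (ξ ⬝ᵥ x) - (A *ᵥ ξ) ⬝ᵥ ξ ≤ (A⁻¹ *ᵥ x) ⬝ᵥ x := by
  have hdet : IsUnit A.det := hA.det_pos.ne'.isUnit
  have hsymm : Aᵀ = A := by simpa [Matrix.IsHermitian] using hA.isHermitian
  have hAy : A *ᵥ (A⁻¹ *ᵥ x) = x := by
    rw [Matrix.mulVec_mulVec, Matrix.mul_nonsing_inv _ hdet, Matrix.one_mulVec]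
  set y := A⁻¹ *ᵥ x with hy
  have h0 : 0 ≤ (ξ - y) ⬝ᵥ (A *ᵥ (ξ - y)) := by
    simpa using hA.posSemidef.dotProduct_mulVec_nonneg (ξ - y)
  have hc : y ⬝ᵥ (A *ᵥ ξ) = ξ ⬝ᵥ x := by
    rw [Matrix.dotProduct_mulVec, ← Matrix.mulVec_transpose, hsymm, hAy, dotProduct_comm]
  rw [Matrix.mulVec_sub, hAy, sub_dotProduct, dotProduct_sub, dotProduct_sub, hc] at h0
  rw [dotProduct_comm (A *ᵥ ξ)]
  linarith

/-- Joint subadditivity of `(A, x) ↦ ⟨A⁻¹ x, x⟩`, the second summand transported by `E`. The left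
side is attained at `ξ = (A + E D E^*)⁻¹ (u + E w)`, where it splits into the two variational
expressions for `(A, u)` at `ξ` and for `(D, w)` at `E^* ξ`. -/
theorem inv_quadForm_add_le {n : Type*} [Fintype n] [DecidableEq n] {A D E : Matrix n n ℝ}
    (hA : A.PosDef) (hD : D.PosDef) (hS : IsUnit (A + E * D * Eᵀ).det) (u w : n → ℝ) :
    ((A + E * D * Eᵀ)⁻¹ *ᵥ (u + E *ᵥ w)) ⬝ᵥ (u + E *ᵥ w) ≤
      (A⁻¹ *ᵥ u) ⬝ᵥ u + (D⁻¹ *ᵥ w) ⬝ᵥ w := by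
  set ξ := (A + E * D * Eᵀ)⁻¹ *ᵥ (u + E *ᵥ w) with hξ
  have h : (A + E * D * Eᵀ) *ᵥ ξ = u + E *ᵥ w := by
    rw [hξ, Matrix.mulVec_mulVec, Matrix.mul_nonsing_inv _ hS, Matrix.one_mulVec]
  have h1 := two_dotProduct_sub_le hA ξ u
  have h2 := two_dotProduct_sub_le hD (Eᵀ *ᵥ ξ) w
  have h3 : (Eᵀ *ᵥ ξ) ⬝ᵥ w = ξ ⬝ᵥ (E *ᵥ w) := by
    rw [Matrix.mulVec_transpose, Matrix.dotProduct_mulVec]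
  have h4 : (D *ᵥ (Eᵀ *ᵥ ξ)) ⬝ᵥ (Eᵀ *ᵥ ξ) = ((E * D * Eᵀ) *ᵥ ξ) ⬝ᵥ ξ := by
    rw [dotProduct_comm, Matrix.mulVec_transpose, ← Matrix.dotProduct_mulVec, dotProduct_comm,
      ← Matrix.mulVec_transpose, Matrix.mulVec_mulVec, Matrix.mulVec_mulVec, Matrix.mul_assoc]
  have h5 : (A *ᵥ ξ) ⬝ᵥ ξ + ((E * D * Eᵀ) *ᵥ ξ) ⬝ᵥ ξ = ξ ⬝ᵥ (u + E *ᵥ w) := by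
    rw [← add_dotProduct, ← Matrix.add_mulVec, h, dotProduct_comm]
  rw [dotProduct_add] at h5 ⊢
  linarith

/-! ### The covariance matrices -/

section
open scoped Matrix.Norms.Operator

theorem continuous_exp_smul {N : ℕ} (B : Matrix (Fin N) (Fin N) ℝ) :
    Continuous fun s : ℝ => NormedSpace.exp (s • B) :=
  NormedSpace.exp_continuous.comp (by fun_prop)

/-- Entrywise integration of a continuous matrix function is its Bochner integral. The operator norm
only serves to make sense of the latter. -/
theorem intervalIntegral_entry {N : ℕ} {f : ℝ → Matrix (Fin N) (Fin N) ℝ} (hf : Continuous f)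
    (a b : ℝ) : (Matrix.of fun i j => ∫ s in a..b, f s i j) = ∫ s in a..b, f s := by
  ext i j
  exact ((Matrix.entryLinearMap ℝ ℝ i j).toContinuousLinearMap.intervalIntegral_comp_comm
    (hf.intervalIntegrable a b))

/-- The cocycle property `P_t = P_s + e^{tB} C(t-s) e^{tB^*}` of `P_t = t K(t)`. -/
theorem covInt_eq_add {N : ℕ} (Q B : Matrix (Fin N) (Fin N) ℝ) (s t : ℝ) :
    covInt Q B t = covInt Q B s +
      NormedSpace.exp (t • B) * C Q B (t - s) * (NormedSpace.exp (t • B))ᵀ := by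
  have hf : Continuous fun σ : ℝ =>
      NormedSpace.exp (σ • B) * Q * NormedSpace.exp (σ • Bᵀ) :=
    ((continuous_exp_smul B).mul continuous_const).mul (continuous_exp_smul Bᵀ)
  have hg : Continuous fun σ : ℝ =>
      NormedSpace.exp (-(σ • B)) * Q * NormedSpace.exp (-(σ • Bᵀ)) := by
    refine (hf.comp continuous_neg).congr fun σ => ?_
    simp only [Function.comp, neg_smul]
  have hadd : ∀ (M : Matrix (Fin N) (Fin N) ℝ) (σ : ℝ),
      NormedSpace.exp (t • M) * NormedSpace.exp (-(σ • M)) = NormedSpace.exp ((t - σ) • M) := by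
    intro M σ
    rw [← Matrix.exp_add_of_commute, sub_smul, sub_eq_add_neg]
    exact (((Commute.refl M).smul_left t).smul_right σ).neg_right
  have hadd' : ∀ (M : Matrix (Fin N) (Fin N) ℝ) (σ : ℝ),
      NormedSpace.exp (-(σ • M)) * NormedSpace.exp (t • M) = NormedSpace.exp ((t - σ) • M) := by
    intro M σ
    rw [← Matrix.exp_add_of_commute, sub_smul, sub_eq_neg_add]
    exact (((Commute.refl M).smul_left σ).smul_right t).neg_left
  have hconj : NormedSpace.exp (t • B) *
      (∫ σ in (0 : ℝ)..(t - s), NormedSpace.exp (-(σ • B)) * Q * NormedSpace.exp (-(σ • Bᵀ))) *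
        NormedSpace.exp (t • Bᵀ) =
      ∫ σ in s..t, NormedSpace.exp (σ • B) * Q * NormedSpace.exp (σ • Bᵀ) := by
    have hL : ∫ σ in (0 : ℝ)..(t - s), NormedSpace.exp (t • B) *
        (NormedSpace.exp (-(σ • B)) * Q * NormedSpace.exp (-(σ • Bᵀ)) *
          NormedSpace.exp (t • Bᵀ)) =
        NormedSpace.exp (t • B) * ((∫ σ in (0 : ℝ)..(t - s),
          NormedSpace.exp (-(σ • B)) * Q * NormedSpace.exp (-(σ • Bᵀ))) *
            NormedSpace.exp (t • Bᵀ)) :=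
      ((LinearMap.mulLeft ℝ (NormedSpace.exp (t • B))).comp
        (LinearMap.mulRight ℝ (NormedSpace.exp (t • Bᵀ)))).toContinuousLinearMap
          |>.intervalIntegral_comp_comm (hg.intervalIntegrable (μ := volume) 0 (t - s))
    rw [mul_assoc, ← hL]
    have hcong : ∀ σ : ℝ, NormedSpace.exp (t • B) *
        (NormedSpace.exp (-(σ • B)) * Q * NormedSpace.exp (-(σ • Bᵀ)) *
          NormedSpace.exp (t • Bᵀ)) =
        NormedSpace.exp ((t - σ) • B) * Q * NormedSpace.exp ((t - σ) • Bᵀ) := fun σ => by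
      rw [← hadd B, ← hadd' Bᵀ]
      simp only [mul_assoc]
    simp only [hcong]
    rw [intervalIntegral.integral_comp_sub_left
      (fun σ => NormedSpace.exp (σ • B) * Q * NormedSpace.exp (σ • Bᵀ)) t]
    simp
  rw [covInt, covInt, C, intervalIntegral_entry hf, intervalIntegral_entry hf,
    intervalIntegral_entry hg, ← Matrix.exp_transpose, Matrix.transpose_smul, hconj,
    intervalIntegral.integral_add_adjacent_intervals (hf.intervalIntegrable _ _)
      (hf.intervalIntegrable _ _)]

end

theorem smul_K {N : ℕ} (Q B : Matrix (Fin N) (Fin N) ℝ) {t : ℝ} (ht : t ≠ 0) :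
    t • K Q B t = covInt Q B t := by
  rw [K, smul_smul, mul_one_div_cancel ht, one_smul]

theorem posDef_covInt {N : ℕ} {Q B : Matrix (Fin N) (Fin N) ℝ} {t : ℝ} (ht : 0 < t)
    (hK : (K Q B t).PosDef) : (covInt Q B t).PosDef := by
  rw [← smul_K Q B ht.ne']
  exact hK.smul ht

/-- `C(t)` is congruent to `P_t` through the invertible matrix `e^{tB}`. -/
theorem posDef_C {N : ℕ} {Q B : Matrix (Fin N) (Fin N) ℝ} {t : ℝ}
    (hP : (covInt Q B t).PosDef) : (C Q B t).PosDef := by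
  have h := covInt_eq_add Q B 0 t
  have h0 : covInt Q B 0 = 0 := by
    ext i j
    simp [covInt]
  rw [h0, zero_add, sub_zero] at h
  have hE : IsUnit (NormedSpace.exp (t • B)) := Matrix.isUnit_exp _
  rw [h] at hP
  rw [← Matrix.conjTranspose_eq_transpose_of_trivial] at hP
  exact (Matrix.IsUnit.posDef_star_right_conjugate_iff hE).1 hP

/-! ### Comparison of the Gaussian kernels -/

/-- The heat kernel in terms of `P_t = t K(t)`: the powers of `t` in the exponent cancel, and the
square root in `pseudoDist` is genuine since the form of `K(t)⁻¹` is nonnegative. -/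
theorem heatKernel_eq {N : ℕ} {Q B : Matrix (Fin N) (Fin N) ℝ} {t : ℝ} (ht : 0 < t)
    (hK : (K Q B t).PosDef) (X Y : Pt N) :
    heatKernel Q B X Y t = normConst N / (unitBallVolume N * √(covInt Q B t).det) *
      Real.exp (-(1 / 4) * (((covInt Q B t)⁻¹ *ᵥ (Y - NormedSpace.exp (t • B) *ᵥ X)) ⬝ᵥ
        (Y - NormedSpace.exp (t • B) *ᵥ X))) := by
  have hinv : (covInt Q B t)⁻¹ = t⁻¹ • (K Q B t)⁻¹ := by
    refine Matrix.inv_eq_right_inv ?_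
    rw [← smul_K Q B ht.ne', Matrix.smul_mul, Matrix.mul_smul, smul_smul, mul_inv_cancel₀ ht.ne',
      one_smul, Matrix.mul_nonsing_inv _ hK.det_pos.ne'.isUnit]
  have hnn : 0 ≤ ((K Q B t)⁻¹ *ᵥ (Y - NormedSpace.exp (t • B) *ᵥ X)) ⬝ᵥ
      (Y - NormedSpace.exp (t • B) *ᵥ X) := by
    rw [dotProduct_comm]
    simpa using hK.inv.posSemidef.dotProduct_mulVec_nonneg (Y - NormedSpace.exp (t • B) *ᵥ X)
  rw [heatKernel, pseudoDist, Real.sq_sqrt hnn, V, smul_K Q B ht.ne', hinv, Matrix.smul_mulVec,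
    smul_dotProduct, smul_eq_mul]
  congr 2
  field_simp

theorem normConst_nonneg (N : ℕ) : 0 ≤ normConst N := by
  have := Real.Gamma_pos_of_pos (s := (N : ℝ) / 2 + 1) (by positivity)
  rw [normConst]
  positivity

theorem heatKernel_nonneg {N : ℕ} (Q B : Matrix (Fin N) (Fin N) ℝ) (X Y : Pt N) (t : ℝ) :
    0 ≤ heatKernel Q B X Y t := by
  have := normConst_nonneg N
  have : 0 ≤ unitBallVolume N := ENNReal.toReal_nonneg
  rw [heatKernel, V]
  positivity

theorem heatKernel_le {N : ℕ} {Q B : Matrix (Fin N) (Fin N) ℝ}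
    (hK : ∀ t : ℝ, 0 < t → (K Q B t).PosDef) (X Y W : Pt N) {s t : ℝ} (hs : 0 < s) (hst : s < t) :
    heatKernel Q B Y W s ≤ heatKernel Q B X W t * (t / s) ^ ((N : ℝ) / 2) *
      ((K Q B t).det / (K Q B s).det) ^ ((1 : ℝ) / 2) *
      Real.exp (1 / 4 *
        (((C Q B (t - s))⁻¹ *ᵥ (X - NormedSpace.exp (-((t - s) • B)) *ᵥ Y)) ⬝ᵥ
          (X - NormedSpace.exp (-((t - s) • B)) *ᵥ Y))) := by
  have ht : 0 < t := hs.trans hst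
  have hr : 0 < t - s := sub_pos.2 hst
  have hPs := posDef_covInt hs (hK s hs)
  have hPt := posDef_covInt ht (hK t ht)
  have hC := posDef_C (posDef_covInt hr (hK _ hr))
  set w := X - NormedSpace.exp (-((t - s) • B)) *ᵥ Y with hw
  have hsplit : W - NormedSpace.exp (t • B) *ᵥ X =
      (W - NormedSpace.exp (s • B) *ᵥ Y) + NormedSpace.exp (t • B) *ᵥ (-w) := by
    have h : NormedSpace.exp (t • B) * NormedSpace.exp (-((t - s) • B)) =
        NormedSpace.exp (s • B) := by
      rw [← Matrix.exp_add_of_commute, ← sub_eq_add_neg, ← sub_smul, sub_sub_cancel]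
      exact (((Commute.refl B).smul_left t).smul_right (t - s)).neg_right
    rw [hw, neg_sub, Matrix.mulVec_sub, Matrix.mulVec_mulVec, h]
    abel
  have hquad := inv_quadForm_add_le (E := NormedSpace.exp (t • B)) hPs hC
    (by rw [← covInt_eq_add]; exact hPt.det_pos.ne'.isUnit) (W - NormedSpace.exp (s • B) *ᵥ Y) (-w)
  rw [← covInt_eq_add, ← hsplit, Matrix.mulVec_neg, neg_dotProduct_neg] at hquad
  have hdet : ∀ r : ℝ, 0 < r → √(covInt Q B r).det =
      r ^ ((N : ℝ) / 2) * (K Q B r).det ^ ((1 : ℝ) / 2) := fun r hr => by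
    rw [← smul_K Q B hr.ne', Matrix.det_smul, Fintype.card_fin, Real.sqrt_eq_rpow,
      Real.mul_rpow (by positivity) (hK r hr).det_pos.le, ← Real.rpow_natCast, ← Real.rpow_mul hr.le]
    congr 2
    ring
  have hconst : normConst N / (unitBallVolume N * √(covInt Q B s).det) =
      normConst N / (unitBallVolume N * √(covInt Q B t).det) * (t / s) ^ ((N : ℝ) / 2) *
        ((K Q B t).det / (K Q B s).det) ^ ((1 : ℝ) / 2) := by
    rw [hdet s hs, hdet t ht, Real.div_rpow ht.le hs.le,
      Real.div_rpow (hK t ht).det_pos.le (hK s hs).det_pos.le]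
    have h1 := Real.rpow_pos_of_pos ht ((N : ℝ) / 2)
    have h2 := Real.rpow_pos_of_pos (hK t ht).det_pos ((1 : ℝ) / 2)
    have h3 := Real.rpow_pos_of_pos hs ((N : ℝ) / 2)
    have h4 := Real.rpow_pos_of_pos (hK s hs).det_pos ((1 : ℝ) / 2)
    generalize (K Q B t).det ^ ((1 : ℝ) / 2) = x at *
    generalize (K Q B s).det ^ ((1 : ℝ) / 2) = x' at *
    generalize t ^ ((N : ℝ) / 2) = y at *
    generalize s ^ ((N : ℝ) / 2) = y' at *
    field_simp
  have hnn : 0 ≤ normConst N / (unitBallVolume N * √(covInt Q B s).det) := by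
    have := normConst_nonneg N
    have : 0 ≤ unitBallVolume N := ENNReal.toReal_nonneg
    positivity
  rw [heatKernel_eq hs (hK s hs), heatKernel_eq ht (hK t ht)]
  refine (mul_le_mul_of_nonneg_left (Real.exp_le_exp.2 ?_) hnn).trans_eq
    (b := normConst N / (unitBallVolume N * √(covInt Q B s).det) * Real.exp
      (-(1 / 4) * (((covInt Q B t)⁻¹ *ᵥ (W - NormedSpace.exp (t • B) *ᵥ X)) ⬝ᵥ
        (W - NormedSpace.exp (t • B) *ᵥ X)) + 1 / 4 * (((C Q B (t - s))⁻¹ *ᵥ w) ⬝ᵥ w))) ?_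
  · linarith
  · rw [Real.exp_add, hconst]
    ring

/-! ### The Bessel series -/

/-- The entire function `F_ν(x) = ∑_k x^k / (k! Γ(k+ν+1))`, which carries the analytic part of the
modified Bessel function: `I_ν(y) = (y/2)^ν F_ν(y²/4)`. -/
noncomputable def besselSeries (ν x : ℝ) : ℝ :=
  ∑' k : ℕ, x ^ k / ((k.factorial : ℝ) * Real.Gamma ((k : ℝ) + ν + 1))

theorem Gamma_natCast_add_pos {ν : ℝ} (hν : -1 < ν) (k : ℕ) : 0 < Real.Gamma ((k : ℝ) + ν + 1) :=
  Real.Gamma_pos_of_pos (by have : (0 : ℝ) ≤ k := k.cast_nonneg; linarith)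

theorem summable_besselSeries {ν : ℝ} (hν : -1 < ν) (x : ℝ) :
    Summable fun k : ℕ => x ^ k / ((k.factorial : ℝ) * Real.Gamma ((k : ℝ) + ν + 1)) := by
  refine summable_of_ratio_norm_eventually_le (r := 1 / 2) (by norm_num) ?_
  filter_upwards [eventually_ge_atTop 2, eventually_ge_atTop ⌈2 * |x|⌉₊] with k hk hkx
  have hk' : (2 : ℝ) ≤ k := by exact_mod_cast hk
  have hkx' : 2 * |x| ≤ k := Nat.ceil_le.1 hkx
  have hG := Gamma_natCast_add_pos hν k
  have hf : (0 : ℝ) < k.factorial := by exact_mod_cast k.factorial_pos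
  have hΓ : Real.Gamma (((k + 1 : ℕ) : ℝ) + ν + 1)
      = ((k : ℝ) + ν + 1) * Real.Gamma ((k : ℝ) + ν + 1) := by
    rw [← Real.Gamma_add_one (by linarith)]
    congr 1; push_cast; ring
  have h1 : (0 : ℝ) < (k : ℝ) + ν + 1 := by linarith
  have hstep : x ^ (k + 1) / (((k + 1).factorial : ℝ) * Real.Gamma (((k + 1 : ℕ) : ℝ) + ν + 1))
      = x / (((k : ℝ) + 1) * ((k : ℝ) + ν + 1)) *
        (x ^ k / ((k.factorial : ℝ) * Real.Gamma ((k : ℝ) + ν + 1))) := by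
    rw [hΓ, Nat.factorial_succ]
    push_cast
    field_simp
    ring
  rw [hstep, norm_mul]
  refine mul_le_mul_of_nonneg_right ?_ (norm_nonneg _)
  rw [Real.norm_eq_abs, abs_div, abs_of_pos (by positivity : 0 < ((k : ℝ) + 1) * ((k : ℝ) + ν + 1)),
    div_le_div_iff₀ (by positivity) (by norm_num)]
  nlinarith

theorem besselSeries_pos {ν : ℝ} (hν : -1 < ν) {x : ℝ} (hx : 0 ≤ x) : 0 < besselSeries ν x := by
  have hpos : ∀ k : ℕ, 0 < ((k.factorial : ℝ) * Real.Gamma ((k : ℝ) + ν + 1)) := fun k =>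
    mul_pos (by exact_mod_cast k.factorial_pos) (Gamma_natCast_add_pos hν k)
  refine (summable_besselSeries hν x).tsum_pos (fun k => ?_) 0 ?_
  · have := hpos k
    positivity
  · have := hpos 0
    rw [pow_zero]
    positivity

theorem besselSeries_monotoneOn {ν : ℝ} (hν : -1 < ν) :
    MonotoneOn (besselSeries ν) (Ici 0) := fun x hx y _ hxy => by
  refine (summable_besselSeries hν x).tsum_le_tsum (fun k => ?_) (summable_besselSeries hν y)
  have : 0 < ((k.factorial : ℝ) * Real.Gamma ((k : ℝ) + ν + 1)) :=
    mul_pos (by exact_mod_cast k.factorial_pos) (Gamma_natCast_add_pos hν k)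
  have hx : 0 ≤ x := hx
  gcongr

theorem hasDerivAt_besselSeries {ν : ℝ} (hν : -1 < ν) (x : ℝ) :
    HasDerivAt (besselSeries ν) (besselSeries (ν + 1) x) x := by
  have hν' : -1 < ν + 1 := by linarith
  have hG := Gamma_natCast_add_pos hν'
  set R : ℝ := |x| + 1
  have hterm : ∀ (k : ℕ) (y : ℝ),
      ((k + 1 : ℕ) : ℝ) * y ^ k / (((k + 1).factorial : ℝ) * Real.Gamma (((k + 1 : ℕ) : ℝ) + ν + 1))
      = y ^ k / ((k.factorial : ℝ) * Real.Gamma ((k : ℝ) + (ν + 1) + 1)) := fun k y => by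
    have h1 := hG k
    have h2 : (0 : ℝ) < k.factorial := by exact_mod_cast k.factorial_pos
    rw [show ((k + 1 : ℕ) : ℝ) + ν + 1 = (k : ℝ) + (ν + 1) + 1 by push_cast; ring,
      Nat.factorial_succ]
    push_cast
    field_simp
  have key := hasDerivAt_tsum_of_isPreconnected
    (u := fun k : ℕ => (k : ℝ) * R ^ (k - 1) / ((k.factorial : ℝ) * Real.Gamma ((k : ℝ) + ν + 1)))
    (g := fun (k : ℕ) (y : ℝ) => y ^ k / ((k.factorial : ℝ) * Real.Gamma ((k : ℝ) + ν + 1)))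
    (g' := fun (k : ℕ) (y : ℝ) =>
      (k : ℝ) * y ^ (k - 1) / ((k.factorial : ℝ) * Real.Gamma ((k : ℝ) + ν + 1)))
    (t := Metric.ball 0 R) (y₀ := 0) (y := x) ?_ Metric.isOpen_ball
    (convex_ball _ _).isPreconnected (fun k y _ => (hasDerivAt_pow k y).div_const _) ?_
    (by simp [R]; positivity) (summable_besselSeries hν 0) (by simp [R])
  · refine key.congr_deriv ?_
    rw [besselSeries, Summable.tsum_eq_zero_add]
    · simp only [Nat.cast_zero, zero_mul, zero_div, zero_add, Nat.add_sub_cancel, hterm]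
    · rw [← summable_nat_add_iff 1]
      simpa only [Nat.add_sub_cancel, hterm] using summable_besselSeries hν' x
  · rw [← summable_nat_add_iff 1]
    simpa only [Nat.add_sub_cancel, hterm] using summable_besselSeries hν' R
  · intro k y hy
    have h3 := Gamma_natCast_add_pos hν k
    rw [norm_div, norm_mul, norm_pow, Real.norm_of_nonneg (Nat.cast_nonneg k),
      Real.norm_of_nonneg (by positivity :
        0 ≤ (k.factorial : ℝ) * Real.Gamma ((k : ℝ) + ν + 1))]
    have : ‖y‖ ≤ R := (mem_ball_zero_iff.1 hy).le
    gcongr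

/-- The contiguity relation between three consecutive Bessel functions. -/
theorem besselSeries_recurrence {ν : ℝ} (hν : -1 < ν) (x : ℝ) :
    besselSeries ν x = (ν + 1) * besselSeries (ν + 1) x + x * besselSeries (ν + 2) x := by
  have h1 := summable_besselSeries (ν := ν + 1) (by linarith) x
  have h2 := summable_besselSeries (ν := ν + 2) (by linarith) x
  have hsplit : ∀ k : ℕ, x ^ k / ((k.factorial : ℝ) * Real.Gamma ((k : ℝ) + ν + 1)) =
      (ν + 1) * (x ^ k / ((k.factorial : ℝ) * Real.Gamma ((k : ℝ) + (ν + 1) + 1))) +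
        (k : ℝ) * x ^ k / ((k.factorial : ℝ) * Real.Gamma ((k : ℝ) + (ν + 1) + 1)) := fun k => by
    have hk : (0 : ℝ) ≤ k := k.cast_nonneg
    have hG := Gamma_natCast_add_pos hν k
    have hf : (0 : ℝ) < k.factorial := by exact_mod_cast k.factorial_pos
    have h3 : (0 : ℝ) < (k : ℝ) + ν + 1 := by linarith
    rw [show (k : ℝ) + (ν + 1) + 1 = ((k : ℝ) + ν + 1) + 1 by ring, Real.Gamma_add_one h3.ne']
    field_simp
    ring
  have hshift : ∀ k : ℕ, ((k + 1 : ℕ) : ℝ) * x ^ (k + 1) /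
      (((k + 1).factorial : ℝ) * Real.Gamma (((k + 1 : ℕ) : ℝ) + (ν + 1) + 1)) =
      x * (x ^ k / ((k.factorial : ℝ) * Real.Gamma ((k : ℝ) + (ν + 2) + 1))) := fun k => by
    have hG := Gamma_natCast_add_pos (ν := ν + 2) (by linarith) k
    have hf : (0 : ℝ) < k.factorial := by exact_mod_cast k.factorial_pos
    rw [show ((k + 1 : ℕ) : ℝ) + (ν + 1) + 1 = (k : ℝ) + (ν + 2) + 1 by push_cast; ring,
      Nat.factorial_succ]
    push_cast
    field_simp
    ring
  have h3 : Summable fun k : ℕ =>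
      (k : ℝ) * x ^ k / ((k.factorial : ℝ) * Real.Gamma ((k : ℝ) + (ν + 1) + 1)) := by
    rw [← summable_nat_add_iff 1]
    simpa only [hshift] using h2.mul_left x
  rw [besselSeries, tsum_congr hsplit, (h1.mul_left _).tsum_add h3, tsum_mul_left,
    h3.tsum_eq_zero_add]
  simp only [hshift, tsum_mul_left, besselSeries]
  simp

/-- The bound `I_{ν+1} ≤ I_ν` for `ν ≥ -1/2`, at the argument `2y` and without the common power. -/
theorem mul_besselSeries_add_one_le {ν : ℝ} (hν : -1 / 2 ≤ ν) (y : ℝ) :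
    y * besselSeries (ν + 1) (y ^ 2) ≤ besselSeries ν (y ^ 2) := by
  have hν1 : -1 < ν := by linarith
  -- The derivative of `F_ν² - x F_{ν+1}²` is `(2ν + 1) F_{ν+1}²`.
  have hderiv : ∀ x : ℝ, HasDerivAt
      (fun x => besselSeries ν x ^ 2 - x * besselSeries (ν + 1) x ^ 2)
      ((2 * ν + 1) * besselSeries (ν + 1) x ^ 2) x := fun x => by
    have h1 := hasDerivAt_besselSeries hν1 x
    have h2 := hasDerivAt_besselSeries (ν := ν + 1) (by linarith) x
    refine ((h1.pow 2).sub ((hasDerivAt_id x).mul (h2.pow 2))).congr_deriv ?_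
    rw [besselSeries_recurrence hν1 x, show ν + 1 + 1 = ν + 2 by ring]
    simp only [id, Nat.cast_ofNat, Pi.pow_apply]
    ring
  have hmono : Monotone fun x => besselSeries ν x ^ 2 - x * besselSeries (ν + 1) x ^ 2 :=
    monotone_of_hasDerivAt_nonneg hderiv
      fun x => mul_nonneg (by linarith) (sq_nonneg _)
  have h := hmono (sq_nonneg y)
  simp only [zero_mul, sub_zero] at h
  refine abs_le_of_sq_le_sq' ?_ (besselSeries_pos hν1 (sq_nonneg y)).le |>.2
  nlinarith [sq_nonneg (besselSeries ν 0)]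

/-- `e^{-y} y^{-ν} I_ν(y)` is decreasing for `ν ≥ -1/2`. -/
theorem antitoneOn_exp_neg_mul_besselSeries {ν : ℝ} (hν : -1 / 2 ≤ ν) :
    AntitoneOn (fun y => Real.exp (-y) * besselSeries ν ((y / 2) ^ 2)) (Ici 0) := by
  have hν1 : -1 < ν := by linarith
  have hderiv : ∀ y : ℝ, HasDerivAt (fun y => Real.exp (-y) * besselSeries ν ((y / 2) ^ 2))
      (Real.exp (-y) *
        (y / 2 * besselSeries (ν + 1) ((y / 2) ^ 2) - besselSeries ν ((y / 2) ^ 2))) y := fun y => by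
    have h1 : HasDerivAt (fun y : ℝ => (y / 2) ^ 2) (y / 2) y :=
      (((hasDerivAt_id y).div_const 2).pow 2).congr_deriv (by simp; ring)
    have h2 := (hasDerivAt_besselSeries hν1 ((y / 2) ^ 2)).comp y h1
    refine ((hasDerivAt_neg y).exp.mul h2).congr_deriv ?_
    simp only [Function.comp]
    ring
  refine antitoneOn_of_hasDerivWithinAt_nonpos (convex_Ici 0)
    (fun y _ => (hderiv y).continuousAt.continuousWithinAt)
    (fun y _ => (hderiv y).hasDerivWithinAt) fun y hy => ?_
  rw [interior_Ici] at hy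
  have hy : 0 < y := hy
  have := mul_besselSeries_add_one_le hν (y / 2)
  exact mul_nonpos_of_nonneg_of_nonpos (Real.exp_pos _).le (by linarith)

/-! ### Comparison of the Bessel kernels -/

theorem besselKernel_of_pos (a : ℝ) {z w t : ℝ} (hz : 0 < z) (hw : 0 < w) (ht : 0 < t) :
    besselKernel a z w t = (2 * t) ^ (-(a + 1) / 2) * 2 ^ ((1 - a) / 2) *
      besselSeries ((a - 1) / 2) ((z * w / (2 * t) / 2) ^ 2) *
        Real.exp (-(z ^ 2 + w ^ 2) / (4 * t)) := by
  set ν : ℝ := (a - 1) / 2 with hν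
  have hy : 0 < z * w / (2 * t) := by positivity
  set y := z * w / (2 * t)
  have hy2 : 0 < y / 2 := by positivity
  have hI : besselI ν y = (y / 2) ^ ν * besselSeries ν ((y / 2) ^ 2) := by
    simp only [besselI, besselSeries]
    rw [← tsum_mul_left]
    refine tsum_congr fun k => ?_
    rw [Real.rpow_add hy2, mul_comm (2 : ℝ), mul_comm (k : ℝ), Real.rpow_mul hy2.le]
    simp only [Real.rpow_natCast, Real.rpow_ofNat]
    ring
  have hpow : y ^ ((1 - a) / 2) * (y / 2) ^ ν = 2 ^ ((1 - a) / 2) := by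
    rw [show (1 - a) / 2 = -ν by rw [hν]; ring, Real.div_rpow hy.le (by norm_num),
      Real.rpow_neg hy.le, Real.rpow_neg (by norm_num)]
    have := Real.rpow_pos_of_pos hy ν
    field_simp
  rw [besselKernel, if_neg hz.ne', hI, ← hpow]
  ring

/-- The subadditivity `(x+y)²/(p+q) ≤ x²/p + y²/q`, with `p = s` and `q = t - s`. -/
theorem add_sq_div_le {s t : ℝ} (hs : 0 < s) (hst : s < t) (x y : ℝ) :
    (x + y) ^ 2 / t ≤ x ^ 2 / s + y ^ 2 / (t - s) := by
  have hr : 0 < t - s := sub_pos.2 hst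
  have ht : 0 < t := hs.trans hst
  rw [div_add_div _ _ hs.ne' hr.ne', div_le_div_iff₀ ht (by positivity)]
  nlinarith [sq_nonneg (x * (t - s) - y * s)]

theorem besselKernel_nonneg {a : ℝ} (ha : -1 < a) {z w t : ℝ} (hz : 0 ≤ z) (hw : 0 < w)
    (ht : 0 < t) : 0 ≤ besselKernel a z w t := by
  rcases hz.eq_or_lt with rfl | hz
  · have := Real.Gamma_pos_of_pos (s := (a + 1) / 2) (by linarith)
    rw [besselKernel, if_pos rfl]
    positivity
  · rw [besselKernel_of_pos a hz hw ht]
    have := besselSeries_pos (ν := (a - 1) / 2) (by linarith)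
      (sq_nonneg (z * w / (2 * t) / 2))
    positivity

theorem besselKernel_le {a : ℝ} (ha : 0 ≤ a) {z ζ w s t : ℝ} (hz : 0 < z) (hζ : 0 < ζ)
    (hw : 0 < w) (hs : 0 < s) (hst : s < t) :
    besselKernel a ζ w s ≤ besselKernel a z w t * (t / s) ^ ((a + 1) / 2) *
      Real.exp (|z - ζ| ^ 2 / (4 * (t - s))) := by
  have ht : 0 < t := hs.trans hst
  have hr : 0 < t - s := sub_pos.2 hst
  rw [besselKernel_of_pos a hζ hw hs, besselKernel_of_pos a hz hw ht, sq_abs]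
  set F := besselSeries ((a - 1) / 2)
  have hpow : (2 * t) ^ (-(a + 1) / 2) * (t / s) ^ ((a + 1) / 2) = (2 * s) ^ (-(a + 1) / 2) := by
    rw [show t / s = (2 * t) / (2 * s) by field_simp, Real.div_rpow (by positivity) (by positivity),
      neg_div, Real.rpow_neg (by positivity), Real.rpow_neg (by positivity)]
    have := Real.rpow_pos_of_pos (show 0 < 2 * t by positivity) ((a + 1) / 2)
    field_simp
  have key : F ((ζ * w / (2 * s) / 2) ^ 2) * Real.exp (-(ζ ^ 2 + w ^ 2) / (4 * s)) ≤
      F ((z * w / (2 * t) / 2) ^ 2) * (Real.exp (-(z ^ 2 + w ^ 2) / (4 * t)) *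
        Real.exp ((z - ζ) ^ 2 / (4 * (t - s)))) := by
    have hFpos : ∀ y : ℝ, 0 < F (y ^ 2) := fun y => besselSeries_pos (by linarith) (sq_nonneg y)
    -- Either the argument of the Bessel function grows, and `F` is increasing, or it shrinks, and
    -- `e^{-y} F(y²/4)` is decreasing.
    rcases le_total (ζ * w / (2 * s)) (z * w / (2 * t)) with h | h
    · rw [← Real.exp_add]
      refine mul_le_mul (besselSeries_monotoneOn (by linarith) (mem_Ici.2 (sq_nonneg _))
        (mem_Ici.2 (sq_nonneg _)) ?_)
        (Real.exp_le_exp.2 ?_) (Real.exp_pos _).le (hFpos _).le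
      · have : 0 ≤ ζ * w / (2 * s) := by positivity
        gcongr
      · have h1 := add_sq_div_le hs hst ζ (z - ζ)
        have h2 : w ^ 2 / t ≤ w ^ 2 / s := by gcongr
        rw [add_sub_cancel] at h1
        rw [show -(ζ ^ 2 + w ^ 2) / (4 * s) = -(ζ ^ 2 / s + w ^ 2 / s) / 4 by field_simp,
          show -(z ^ 2 + w ^ 2) / (4 * t) = -(z ^ 2 / t + w ^ 2 / t) / 4 by field_simp,
          show (z - ζ) ^ 2 / (4 * (t - s)) = ((z - ζ) ^ 2 / (t - s)) / 4 by field_simp]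
        linarith
    · have hanti := antitoneOn_exp_neg_mul_besselSeries (ν := (a - 1) / 2) (by linarith)
        (show 0 ≤ z * w / (2 * t) by positivity) (show 0 ≤ ζ * w / (2 * s) by positivity) h
      -- Completing the squares turns the exponents into `-(ζ-w)²/4s` and `-(z-w)²/4t`.
      have hexp : Real.exp (ζ * w / (2 * s) + -(ζ ^ 2 + w ^ 2) / (4 * s)) ≤
          Real.exp (z * w / (2 * t) + -(z ^ 2 + w ^ 2) / (4 * t) +
            (z - ζ) ^ 2 / (4 * (t - s))) := by
        refine Real.exp_le_exp.2 ?_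
        have h1 := add_sq_div_le hs hst (ζ - w) (z - ζ)
        rw [show ζ - w + (z - ζ) = z - w by ring] at h1
        rw [show ζ * w / (2 * s) + -(ζ ^ 2 + w ^ 2) / (4 * s) = -((ζ - w) ^ 2 / s) / 4 by
            field_simp; ring,
          show z * w / (2 * t) + -(z ^ 2 + w ^ 2) / (4 * t) = -((z - w) ^ 2 / t) / 4 by
            field_simp; ring,
          show (z - ζ) ^ 2 / (4 * (t - s)) = ((z - ζ) ^ 2 / (t - s)) / 4 by field_simp]
        linarith
      have := mul_le_mul hanti hexp (Real.exp_pos _).le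
        (mul_pos (Real.exp_pos _) (hFpos _)).le
      have hcancel : ∀ y E G : ℝ, Real.exp (-y) * G * (Real.exp y * E) = G * E := fun y E G => by
        rw [Real.exp_neg]
        field_simp
      rwa [Real.exp_add, add_assoc, Real.exp_add (z * w / (2 * t)), hcancel, hcancel,
        Real.exp_add] at this
  rw [← hpow]
  have hc : 0 ≤ (2 * t) ^ (-(a + 1) / 2) * (t / s) ^ ((a + 1) / 2) * 2 ^ ((1 - a) / 2) := by
    positivity
  calc _ = (2 * t) ^ (-(a + 1) / 2) * (t / s) ^ ((a + 1) / 2) * 2 ^ ((1 - a) / 2) *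
        (F ((ζ * w / (2 * s) / 2) ^ 2) * Real.exp (-(ζ ^ 2 + w ^ 2) / (4 * s))) := by ring
    _ ≤ _ := mul_le_mul_of_nonneg_left key hc
    _ = _ := by ring

theorem besselKernel_zero_le {a : ℝ} (ha : -1 < a) {w s t : ℝ} (hs : 0 < s) (hst : s < t) :
    besselKernel a 0 w s ≤ besselKernel a 0 w t * (t / s) ^ ((a + 1) / 2) := by
  have ht : 0 < t := hs.trans hst
  have hΓ := Real.Gamma_pos_of_pos (s := (a + 1) / 2) (by linarith)
  have hpow : t ^ (-(a + 1) / 2) * (t / s) ^ ((a + 1) / 2) = s ^ (-(a + 1) / 2) := by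
    rw [Real.div_rpow ht.le hs.le, neg_div, Real.rpow_neg ht.le, Real.rpow_neg hs.le]
    have := Real.rpow_pos_of_pos ht ((a + 1) / 2)
    field_simp
  have hexp : Real.exp (-w ^ 2 / (4 * s)) ≤ Real.exp (-w ^ 2 / (4 * t)) := by
    rw [neg_div, neg_div]
    gcongr
  rw [besselKernel, besselKernel, if_pos rfl, if_pos rfl, ← hpow]
  calc _ ≤ 1 / ((2 : ℝ) ^ a * Real.Gamma ((a + 1) / 2)) *
        (t ^ (-(a + 1) / 2) * (t / s) ^ ((a + 1) / 2)) * Real.exp (-w ^ 2 / (4 * t)) := by gcongr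
    _ = _ := by ring

theorem continuousOn_besselKernel {a : ℝ} (ha : -1 < a) {z t : ℝ} (hz : 0 ≤ z) (ht : 0 < t) :
    ContinuousOn (fun w => besselKernel a z w t) (Ioi 0) := by
  rcases hz.eq_or_lt with rfl | hz
  · simp only [besselKernel, if_true]
    fun_prop
  · refine ContinuousOn.congr ?_ fun w hw => besselKernel_of_pos a hz hw ht
    have hF : Continuous (besselSeries ((a - 1) / 2)) := continuous_iff_continuousAt.2 fun x =>
      (hasDerivAt_besselSeries (by linarith) x).continuousAt
    have : Continuous fun w => besselSeries ((a - 1) / 2) ((z * w / (2 * t) / 2) ^ 2) :=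
      hF.comp (by fun_prop)
    fun_prop

/-! ### Integration against a test function -/

/-- The factor `besselKernel a z w t * w ^ a` may be discontinuous at `w = 0`; the product is still
continuous on the whole space because the support of `φ` stays away from that hyperplane. -/
theorem continuous_extSemigroup_integrand {N : ℕ} {Q B : Matrix (Fin N) (Fin N) ℝ} {a t : ℝ}
    (ha : -1 < a) (ht : 0 < t) {φ : Pt N × ℝ → ℝ} (hφ : IsTestFunction φ) (X : Pt N) {z : ℝ}
    (hz : 0 ≤ z) :
    Continuous fun P : Pt N × ℝ =>
      φ P * (heatKernel Q B X P.1 t * besselKernel a z P.2 t * P.2 ^ a) := by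
  have hopen : IsOpen {P : Pt N × ℝ | 0 < P.2} := isOpen_lt continuous_const continuous_snd
  have hheat : Continuous fun Y : Pt N => heatKernel Q B X Y t := by
    simp only [heatKernel, pseudoDist]
    fun_prop
  have hon : ContinuousOn (fun P : Pt N × ℝ =>
      φ P * (heatKernel Q B X P.1 t * besselKernel a z P.2 t * P.2 ^ a)) {P | 0 < P.2} := by
    refine hφ.1.continuous.continuousOn.mul
      (((hheat.comp continuous_fst).continuousOn.mul ?_).mul ?_)
    · exact (continuousOn_besselKernel ha hz ht).comp continuous_snd.continuousOn fun P hP => hP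
    · exact continuous_snd.continuousOn.rpow_const fun P hP => Or.inl (ne_of_gt hP)
  refine continuous_of_tsupport fun P hP => hon.continuousAt (hopen.mem_nhds ?_)
  exact hφ.2.2 (tsupport_mul_subset_left hP)

/-- A pointwise comparison of the kernels passes to the semigroup. -/
theorem extSemigroup_le {N : ℕ} {Q B : Matrix (Fin N) (Fin N) ℝ} {a s t : ℝ} (ha : -1 < a)
    (hs : 0 < s) (ht : 0 < t) {φ : Pt N × ℝ → ℝ} (hφ : IsTestFunction φ) (hφ0 : ∀ P, 0 ≤ φ P)
    {X Y : Pt N} {z ζ : ℝ} (hz : 0 ≤ z) (hζ : 0 ≤ ζ) {c : ℝ}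
    (hle : ∀ (W : Pt N) (w : ℝ), 0 < w → heatKernel Q B Y W s * besselKernel a ζ w s ≤
      heatKernel Q B X W t * besselKernel a z w t * c) :
    extSemigroup Q B a s φ Y ζ ≤ extSemigroup Q B a t φ X z * c := by
  have hcont := continuous_extSemigroup_integrand (Q := Q) (B := B) ha ht hφ X hz
  have hint : Integrable (fun P : Pt N × ℝ => heatKernel Q B X P.1 t * besselKernel a z P.2 t *
      φ P * P.2 ^ a * c) (volume.prod volume) := by
    refine ((hcont.integrable_of_hasCompactSupport (μ := volume.prod volume)
      hφ.2.1.mul_right).mul_const c).congr (Eventually.of_forall fun P => ?_)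
    ring
  have hint1 : ∀ w : ℝ, Integrable (fun W : Pt N =>
      heatKernel Q B X W t * besselKernel a z w t * φ (W, w) * w ^ a * c) := fun w => by
    have hsupp : HasCompactSupport fun W : Pt N =>
        φ (W, w) * (heatKernel Q B X W t * besselKernel a z w t * w ^ a) := by
      refine HasCompactSupport.mul_right (f := fun W : Pt N => φ (W, w)) ?_
      refine HasCompactSupport.intro (hφ.2.1.image continuous_fst) fun W hW => ?_
      by_contra h
      exact hW ⟨(W, w), subset_tsupport _ h, rfl⟩
    refine (((hcont.comp (Continuous.prodMk_left w)).integrable_of_hasCompactSupport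
      hsupp).mul_const c).congr (Eventually.of_forall fun W => ?_)
    simp only [Function.comp]
    ring
  have hnonneg : ∀ (W : Pt N) (w : ℝ), 0 < w →
      0 ≤ heatKernel Q B Y W s * besselKernel a ζ w s * φ (W, w) * w ^ a := fun W w hw => by
    have h1 := heatKernel_nonneg Q B Y W s
    have h2 := besselKernel_nonneg ha hζ hw hs
    have h3 := hφ0 (W, w)
    positivity
  simp only [extSemigroup, neumannKernel, sub_zero]
  rw [← integral_mul_const]
  simp only [← integral_mul_const]
  refine integral_mono_of_nonneg ?_ hint.integral_prod_right.integrableOn ?_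
  · filter_upwards [ae_restrict_mem measurableSet_Ioi] with w hw
    exact integral_nonneg fun W => hnonneg W w hw
  · filter_upwards [ae_restrict_mem measurableSet_Ioi] with w hw
    refine integral_mono_of_nonneg (Eventually.of_forall fun W => hnonneg W w hw) (hint1 w)
      (Eventually.of_forall fun W => ?_)
    have hw : 0 < w := hw
    have h := mul_le_mul_of_nonneg_right (hle W w hw)
      (mul_nonneg (hφ0 (W, w)) (Real.rpow_nonneg hw.le a))
    calc _ = heatKernel Q B Y W s * besselKernel a ζ w s * (φ (W, w) * w ^ a) := by ring
      _ ≤ _ := h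
      _ = _ := by ring

end KolmogorovExtension

theorem theorem5 (N : ℕ) (hN : 2 ≤ N) (Q B : Matrix (Fin N) (Fin N) ℝ)
    (hQ : Q.PosSemidef) (hK : ∀ t : ℝ, 0 < t → (K Q B t).PosDef)
    (φ : Pt N × ℝ → ℝ) (hφ : IsTestFunction φ) (hφ0 : ∀ P, 0 ≤ φ P)
    (X Y : Pt N) (s t : ℝ) (hs : 0 < s) (hst : s < t) :
    (∀ a : ℝ, 0 ≤ a → ∀ z ζ : ℝ, 0 < z → 0 < ζ →
      extSemigroup Q B a s φ Y ζ ≤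
        extSemigroup Q B a t φ X z * (t / s) ^ (((N : ℝ) + a + 1) / 2) *
          ((K Q B t).det / (K Q B s).det) ^ ((1 : ℝ) / 2) *
          Real.exp (|z - ζ| ^ 2 / (4 * (t - s))) *
          Real.exp (1 / 4 *
            (((C Q B (t - s))⁻¹ *ᵥ (X - NormedSpace.exp (-((t - s) • B)) *ᵥ Y)) ⬝ᵥ
              (X - NormedSpace.exp (-((t - s) • B)) *ᵥ Y)))) ∧
    (∀ a : ℝ, -1 < a →
      extSemigroup Q B a s φ Y 0 ≤
        extSemigroup Q B a t φ X 0 * (t / s) ^ (((N : ℝ) + a + 1) / 2) *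
          ((K Q B t).det / (K Q B s).det) ^ ((1 : ℝ) / 2) *
          Real.exp (1 / 4 *
            (((C Q B (t - s))⁻¹ *ᵥ (X - NormedSpace.exp (-((t - s) • B)) *ᵥ Y)) ⬝ᵥ
              (X - NormedSpace.exp (-((t - s) • B)) *ᵥ Y)))) := by

  have ht : 0 < t := hs.trans hst
  have hpow : ∀ a : ℝ, (t / s) ^ (((N : ℝ) + a + 1) / 2) =
      (t / s) ^ ((N : ℝ) / 2) * (t / s) ^ ((a + 1) / 2) := fun a => by
    rw [← Real.rpow_add (by positivity)]
    congr 1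
    ring
  have hprod : ∀ (W : Pt N) {p q e f : ℝ}, 0 ≤ p → p ≤ q * e * f →
      heatKernel Q B Y W s * p ≤ heatKernel Q B X W t * q * ((t / s) ^ ((N : ℝ) / 2) * e *
        ((K Q B t).det / (K Q B s).det) ^ ((1 : ℝ) / 2) * f * Real.exp (1 / 4 *
            (((C Q B (t - s))⁻¹ *ᵥ (X - NormedSpace.exp (-((t - s) • B)) *ᵥ Y)) ⬝ᵥ
              (X - NormedSpace.exp (-((t - s) • B)) *ᵥ Y)))) := fun W p q e f hp hpq => by
    have h := heatKernel_le hK X Y W hs hst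
    refine (mul_le_mul h hpq hp ((heatKernel_nonneg Q B Y W s).trans h)).trans_eq ?_
    ring
  refine ⟨fun a ha z ζ hz hζ => ?_, fun a ha => ?_⟩
  · have ha1 : -1 < a := by linarith
    refine (extSemigroup_le ha1 hs ht hφ hφ0 hz.le hζ.le fun W w hw =>
      hprod W (besselKernel_nonneg ha1 hζ.le hw hs)
        (besselKernel_le ha hz hζ hw hs hst)).trans_eq ?_
    rw [hpow]
    ring
  · refine (extSemigroup_le ha hs ht hφ hφ0 le_rfl le_rfl fun W w hw =>
      hprod W (f := 1) (besselKernel_nonneg ha le_rfl hw hs)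
        (by rw [mul_one]; exact besselKernel_zero_le ha hs hst)).trans_eq ?_
    rw [hpow]
    ring
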